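/- **Notation.** For a symmetric matrix $B=U\,\mathrm{diag}(\mu_1,\dots,\mu_m)\,U^T$ with $U$ orthogonal, $f(B)=U\,\mathrm{diag}(f(\mu_1),\dots,f(\mu_m))\,U^T$. For a matrix $B$, $[\![B]\!]_k$ denotes a rank-$k$ truncation of a singular value decomposition of $B$ (only the $k$ largest singular values are kept). $\mathbb P_m$ is the set of real polynomials of degree at most $m$, and $\|g\|_{L^\infty(I)}=\sup_{x\in I}|g(x)|\in[0,\infty]$. **Block-Lanczos algorithm.** Let $A\in\mathbb R^{n\times n}$ be symmetric. On a starting block $Z$, the algorithm computes a matrix $V_0$ whose columns are an orthonormal basis of $\mathrm{range}(Z)$, and $R_0=V_0^TZ$. Then, for $i=1,2,\dots$, it computes $Y=AV_{i-1}-V_{i-2}R_{i-1}^T$ ($Y=AV_0$ if $i=1$), $M_i=V_{i-1}^TY$, replaces $Y$ by $Y-V_{i-1}M_i$, then $Y$ by $Y-\sum_{j=0}^{i-1}V_jV_j^TY$, computes a matrix $V_i$ whose columns are an orthonormal basis of $\mathrm{range}(Y)$ (possibly with zero columns), and $R_i=V_i^TY$. After $t$ iterations it returns $Q_t=[V_0\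 \cdots\ V_{t-1}]$, whose columns are an orthonormal basis of the block Krylov subspace $\mathcal K_t(A,Z)=\mathrm{range}[Z\ AZ\ \cdots\ A^{t-1}Z]$, and the symmetric block tridiagonal matrix $T_t=Q_t^TAQ_t$ with diagonal blocks $M_1,\dots,M_t$ and subdiagonal blocks $R_1,\dots,R_{t-1}$. **Statement.** Let $n\ge 1$, let $A\in\mathbb R^{n\times n}$ be symmetric with smallest and largest eigenvalues $\lambda_{\min}$ and $\lambda_{\max}$, let $f:\mathbb R\to\mathbb R$, let $s,r\ge 1$ and $0\le k\le\ell$ be integers, and let $\Omega\in\mathbb R^{n\times\ell}$ be any matrix. * *Krylov-aware algorithm.* Run $s+r$ iterations of block-Lanczos on $A$ with starting block $\Omega$. Let $Q_s=[V_0\ \cdots\ V_{s-1}]$, let $d=\dim\mathcal K_s(A,\Omega)$, and let $X$ be the leading principal $d\times d$ submatrix of $f(T_{s+r})$. * *Randomized SVD on $f(A)$ with Lanczos matrix-vector products.* Run $s$ iterations of block-Lanczos on $A$ with the same starting block $\Omega$, and let $K=Q'_s\,f(T'_s)_{:,1}\,R'_0$, where $Q'_s$, $T'_s$, $R'_0$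 are computed in this run and the index $1$ denotes the first block (of size $\mathrm{rank}(\Omega)$). Let the columns of $W$ be an orthonormal basis of $\mathrm{range}(K)$. Run $r$ iterations of block-Lanczos on $A$ with starting block $W$, and let $\widetilde X=\widetilde R_0^T\,f(\widetilde T_r)_{1,1}\,\widetilde R_0$, where $\widetilde T_r$, $\widetilde R_0$ are computed in this run; if $W$ itself is taken as the first basis block, then $\widetilde R_0=I$ and $\widetilde X$ is the leading block $f(\widetilde T_r)_{1,1}$. Then, for all choices of orthonormal bases and of truncated singular value decompositions in these procedures, $$ \bigl\|f(A)-Q_s[\![X]\!]_kQ_s^T\bigr\|_F\;\le\;\bigl\|f(A)-W[\![\widetilde X]\!]_kW^T\bigr\|_F+4\sqrt{\ell s}\,\inf_{p\in\mathbb P_{2r+1}}\|f-p\|_{L^\infty([\lambda_{\min},\lambda_{\max}])}, $$ where the last term is $0$ if $\ell=0$. -/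

import Mathlib

open Matrix Polynomial

noncomputable section

/-- The range (column space) of a real matrix. -/
def matRange {m c : Type*} [Fintype c] (B : Matrix m c ℝ) : Submodule ℝ (m → ℝ) :=
  LinearMap.range B.mulVecLin

/-- The matrix function `f(B)` of a symmetric matrix `B`, given by the functional calculus
(see `matFun_eq` for the description by eigendecompositions). -/
def matFun {m : Type*} [Fintype m] [DecidableEq m] (f : ℝ → ℝ) (B : Matrix m m ℝ) :
    Matrix m m ℝ :=
  cfc f B

/-- If `B = U diag(μ) Uᵀ` with `U` orthogonal, then `f(B) = U diag(f(μ)) Uᵀ`. -/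
theorem matFun_eq {m : Type*} [Fintype m] [DecidableEq m] (f : ℝ → ℝ) (U : Matrix m m ℝ)
    (hU : U * Uᵀ = 1) (μ : m → ℝ) :
    matFun f (U * diagonal μ * Uᵀ) = U * diagonal (fun i => f (μ i)) * Uᵀ := by
  have hU' : Uᵀ * U = 1 := mul_eq_one_comm.mp hU
  have hB : IsSelfAdjoint (U * diagonal μ * Uᵀ) := by
    show star _ = _
    simp [star_eq_conjTranspose, conjTranspose_eq_transpose_of_trivial, Matrix.mul_assoc]
  have hpow : ∀ k : ℕ, (U * diagonal μ * Uᵀ) ^ k = U * diagonal (fun i => μ i ^ k) * Uᵀ := by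
    intro k
    induction k with
    | zero => simp [hU]
    | succ k ih =>
      rw [pow_succ, ih]
      calc U * diagonal (fun i => μ i ^ k) * Uᵀ * (U * diagonal μ * Uᵀ)
          = U * diagonal (fun i => μ i ^ k) * (Uᵀ * U) * diagonal μ * Uᵀ := by
            simp only [Matrix.mul_assoc]
        _ = _ := by rw [hU', Matrix.mul_one, Matrix.mul_assoc U, diagonal_mul_diagonal]; simp [pow_succ]
  have hpoly : ∀ p : ℝ[X], aeval (U * diagonal μ * Uᵀ) p
      = U * diagonal (fun i => p.eval (μ i)) * Uᵀ := by
    intro p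
    induction p using Polynomial.induction_on' with
    | add p q hp hq =>
      rw [map_add, hp, hq, ← Matrix.add_mul, ← Matrix.mul_add, diagonal_add]
      simp
    | monomial k a =>
      rw [aeval_monomial, hpow, Algebra.algebraMap_eq_smul_one, smul_mul_assoc, one_mul,
        ← Matrix.smul_mul, ← Matrix.mul_smul, ← diagonal_smul]
      congr 3
      ext i
      simp
  have hfin : (spectrum ℝ (U * diagonal μ * Uᵀ)).Finite := Matrix.finite_real_spectrum
  let S : Finset ℝ := hfin.toFinset ∪ Finset.univ.image μ
  let p : ℝ[X] := Lagrange.interpolate S id f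
  have hp : ∀ x ∈ S, p.eval x = f x := fun x hx =>
    Lagrange.eval_interpolate_at_node (v := id) f (Set.injOn_id _) hx
  have h1 : matFun f (U * diagonal μ * Uᵀ) = cfc p.eval (U * diagonal μ * Uᵀ) := by
    refine cfc_congr fun x hx => (hp x ?_).symm
    exact Finset.mem_union_left _ (hfin.mem_toFinset.mpr hx)
  rw [h1, cfc_polynomial p _ hB, hpoly]
  congr 3
  ext i
  exact hp _ (Finset.mem_union_right _ (Finset.mem_image_of_mem _ (Finset.mem_univ i)))

section Frobenius

attribute [local instance] Matrix.frobeniusNormedAddCommGroup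

/-- The Frobenius norm. -/
def frobNorm {m c : Type*} [Fintype m] [Fintype c] (B : Matrix m c ℝ) : ℝ := ‖B‖

theorem frobNorm_eq {m c : Type*} [Fintype m] [Fintype c] (B : Matrix m c ℝ) :
    frobNorm B = √(∑ i, ∑ j, B i j ^ 2) := by
  rw [frobNorm, Matrix.frobenius_norm_def, ← Real.sqrt_eq_rpow]
  simp

end Frobenius

/-- `C` is a rank-`k` truncated singular value decomposition of `B`: there is a (thin) singular
value decomposition of `B` with nonincreasing singular values, of which `C` keeps the first `k`
terms. When singular values coincide there may be several such `C`. -/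
def IsTruncatedSVD {m c : Type*} [Fintype m] [Fintype c] (k : ℕ) (B C : Matrix m c ℝ) : Prop :=
  ∃ (d : ℕ) (U : Matrix m (Fin d) ℝ) (V : Matrix c (Fin d) ℝ) (σ : Fin d → ℝ),
    Uᵀ * U = 1 ∧ Vᵀ * V = 1 ∧ Antitone σ ∧ (∀ i, 0 ≤ σ i) ∧
    B = U * diagonal σ * Vᵀ ∧
    C = U * diagonal (fun i : Fin d => if i.1 < k then σ i else 0) * Vᵀ

/-- The columns of `V` form an orthonormal basis of the range of `Y`. -/
def IsOrthonormalBasisOfRange {n d : ℕ} {c : Type*} [Fintype c]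
    (V : Matrix (Fin n) (Fin d) ℝ) (Y : Matrix (Fin n) c ℝ) : Prop :=
  Vᵀ * V = 1 ∧ matRange V = matRange Y

/-- The block Krylov subspace `range [Ω, AΩ, …, A^(s-1) Ω]`. -/
def krylov {n ℓ : ℕ} (A : Matrix (Fin n) (Fin n) ℝ) (Ω : Matrix (Fin n) (Fin ℓ) ℝ) (s : ℕ) :
    Submodule ℝ (Fin n → ℝ) :=
  matRange (Matrix.of fun (x : Fin n) (c : Fin s × Fin ℓ) => (A ^ (c.1 : ℕ) * Ω) x c.2)

/-! The quantities that the block-Lanczos algorithm computes in one iteration. The width of the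
block `V i` is `w i`, which may be smaller than the number of columns of the starting block, and
may be zero. The matrix `M i` is the diagonal block number `i + 1`, and `R i` is the off-diagonal
block number `i + 1`. -/

/-- `A Vᵢ - Vᵢ₋₁ Rᵢᵀ`, where the second term is absent for `i = 0`. -/
def lanczosY {n : ℕ} (A : Matrix (Fin n) (Fin n) ℝ) {w : ℕ → ℕ}
    (V : (i : ℕ) → Matrix (Fin n) (Fin (w i)) ℝ)
    (R : (i : ℕ) → Matrix (Fin (w (i + 1))) (Fin (w i)) ℝ) :
    (i : ℕ) → Matrix (Fin n) (Fin (w i)) ℝ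
  | 0 => A * V 0
  | i + 1 => A * V (i + 1) - V i * (R i)ᵀ

/-- The reorthogonalization `Y - ∑_{j ≤ i} Vⱼ Vⱼᵀ Y`. -/
def reorth {n d : ℕ} {w : ℕ → ℕ} (V : (i : ℕ) → Matrix (Fin n) (Fin (w i)) ℝ) (i : ℕ)
    (Y : Matrix (Fin n) (Fin d) ℝ) : Matrix (Fin n) (Fin d) ℝ :=
  Y - ∑ j ∈ Finset.range (i + 1), V j * ((V j)ᵀ * Y)

/-- A run of `s` iterations of the block-Lanczos algorithm on `A` with starting block `Ω`
(in exact arithmetic), for an arbitrary choice of the orthonormal bases that the algorithm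
computes. Blocks with an index beyond the last iteration are not constrained. -/
structure BlockLanczosRun {n ℓ : ℕ} (A : Matrix (Fin n) (Fin n) ℝ)
    (Ω : Matrix (Fin n) (Fin ℓ) ℝ) (s : ℕ) where
  /-- the widths of the blocks -/
  w : ℕ → ℕ
  /-- the blocks of the orthonormal basis -/
  V : (i : ℕ) → Matrix (Fin n) (Fin (w i)) ℝ
  /-- the diagonal blocks of the block tridiagonal matrix -/
  M : (i : ℕ) → Matrix (Fin (w i)) (Fin (w i)) ℝ
  /-- the factor of the starting block, `Ω = V₀ R₀` -/
  R₀ : Matrix (Fin (w 0)) (Fin ℓ) ℝ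
  /-- the subdiagonal blocks of the block tridiagonal matrix -/
  R : (i : ℕ) → Matrix (Fin (w (i + 1))) (Fin (w i)) ℝ
  V_zero : IsOrthonormalBasisOfRange (V 0) Ω
  R_zero : R₀ = (V 0)ᵀ * Ω
  M_eq : ∀ i < s, M i = (V i)ᵀ * lanczosY A V R i
  V_succ : ∀ i < s,
    IsOrthonormalBasisOfRange (V (i + 1)) (reorth V i (lanczosY A V R i - V i * M i))
  R_succ : ∀ i < s, R i = (V (i + 1))ᵀ * reorth V i (lanczosY A V R i - V i * M i)

namespace BlockLanczosRun

variable {n ℓ : ℕ} {A : Matrix (Fin n) (Fin n) ℝ} {Ω : Matrix (Fin n) (Fin ℓ) ℝ} {N : ℕ}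

/-- The column indices of `[V₀ ⋯ V_{s-1}]`: pairs of a block and a column of this block. -/
abbrev Idx (L : BlockLanczosRun A Ω N) (s : ℕ) : Type := Σ i : Fin s, Fin (L.w i)

/-- `Q_s = [V₀ ⋯ V_{s-1}]`. -/
def Q (L : BlockLanczosRun A Ω N) (s : ℕ) : Matrix (Fin n) (L.Idx s) ℝ :=
  Matrix.of fun x c => L.V c.1 x c.2

/-- The block tridiagonal matrix `T_s` with diagonal blocks `M`, subdiagonal blocks `R` and
superdiagonal blocks `Rᵀ`. -/
def T (L : BlockLanczosRun A Ω N) (s : ℕ) : Matrix (L.Idx s) (L.Idx s) ℝ :=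
  Matrix.of fun a b =>
    if h : (b.1 : ℕ) = a.1 then L.M a.1 a.2 (Fin.cast (congrArg L.w h) b.2)
    else if h : (a.1 : ℕ) = b.1 + 1 then L.R b.1 (Fin.cast (congrArg L.w h) a.2) b.2
    else if h : (b.1 : ℕ) = a.1 + 1 then L.R a.1 (Fin.cast (congrArg L.w h) b.2) a.2
    else 0

theorem transpose_V_mul_V_of_lt (L : BlockLanczosRun A Ω N) (i : ℕ) (hi : i ≤ N) :
    ∀ j < i, (L.V j)ᵀ * L.V i = 0 := by
  induction i using Nat.strong_induction_on with
  | _ i ih =>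
    intro j hj
    obtain ⟨i, rfl⟩ : ∃ m, i = m + 1 := ⟨i - 1, by omega⟩
    have hon : ∀ a ≤ N, (L.V a)ᵀ * L.V a = 1 := by
      intro a ha
      rcases a with _ | a
      · exact L.V_zero.1
      · exact (L.V_succ a ha).1
    have hVV : ∀ a ≤ i, a ≠ j → (L.V j)ᵀ * L.V a = 0 := by
      intro a ha haj
      rcases lt_or_gt_of_ne haj with h | h
      · have := congrArg transpose (ih j hj (by omega) a h)
        simpa using this
      · exact ih a (by omega) (by omega) j h
    set Y := lanczosY A L.V L.R i - L.V i * L.M i with hY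
    have hZ : (L.V j)ᵀ * reorth L.V i Y = 0 := by
      rw [reorth, Matrix.mul_sub, Matrix.mul_sum, Finset.sum_eq_single j]
      · rw [← Matrix.mul_assoc, hon j (by omega), Matrix.one_mul, sub_self]
      · intro a ha haj
        rw [← Matrix.mul_assoc, hVV a (by simpa [Nat.lt_succ_iff] using ha) haj, Matrix.zero_mul]
      · intro h
        exact absurd (Finset.mem_range.mpr hj) h
    have hr : matRange (L.V (i + 1)) = matRange (reorth L.V i Y) := (L.V_succ i hi).2
    ext a b
    have hb : (L.V (i + 1)).col b ∈ matRange (reorth L.V i Y) := by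
      rw [← hr, matRange, Matrix.range_mulVecLin]
      exact Submodule.subset_span ⟨b, rfl⟩
    obtain ⟨v, hv⟩ := hb
    have h0 : (L.V j)ᵀ *ᵥ ((L.V (i + 1)).col b) = 0 := by
      rw [← hv, Matrix.mulVecLin_apply, Matrix.mulVec_mulVec, hZ, Matrix.zero_mulVec]
    exact congrFun h0 a

/-- The columns of `[V₀ ⋯ V_{s-1}]` are orthonormal. -/
theorem transpose_Q_mul_Q (L : BlockLanczosRun A Ω N) {s : ℕ} (hs : s ≤ N + 1) :
    (L.Q s)ᵀ * L.Q s = 1 := by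
  ext ⟨i, a⟩ ⟨j, b⟩
  change ((L.V i)ᵀ * L.V j) a b = _
  have hi := i.2
  have hj := j.2
  rcases lt_trichotomy i j with h | h | h
  · rw [L.transpose_V_mul_V_of_lt j (by omega) i h, Matrix.one_apply_ne]
    · rfl
    · intro h'
      exact h.ne (congrArg Sigma.fst h')
  · subst h
    have hon : (L.V i)ᵀ * L.V i = 1 := by
      rcases i with ⟨_ | i, hi⟩
      · exact L.V_zero.1
      · exact (L.V_succ i (by omega)).1
    rw [hon]
    simp [Matrix.one_apply]
  · have := congrArg transpose (L.transpose_V_mul_V_of_lt i (by omega) j h)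
    rw [transpose_mul, transpose_transpose, transpose_zero] at this
    rw [this, Matrix.one_apply_ne]
    · rfl
    · intro h'
      exact h.ne (congrArg Sigma.fst h').symm

theorem matRange_Q_le (L : BlockLanczosRun A Ω N) {s : ℕ} {P : Submodule ℝ (Fin n → ℝ)} :
    matRange (L.Q s) ≤ P ↔ ∀ i < s, matRange (L.V i) ≤ P := by
  simp only [matRange, Matrix.range_mulVecLin, Submodule.span_le, Set.range_subset_iff]
  exact ⟨fun h i hi a => h ⟨⟨i, hi⟩, a⟩, fun h c => h c.1 c.1.2 c.2⟩

theorem krylov_le {s : ℕ} {P : Submodule ℝ (Fin n → ℝ)} :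
    krylov A Ω s ≤ P ↔ ∀ i < s, matRange (A ^ i * Ω) ≤ P := by
  simp only [krylov, matRange, Matrix.range_mulVecLin, Submodule.span_le, Set.range_subset_iff]
  exact ⟨fun h i hi a => h ⟨⟨i, hi⟩, a⟩, fun h c => h c.1 c.1.2 c.2⟩

theorem map_krylov_le (s : ℕ) :
    (krylov A Ω s).map A.mulVecLin ≤ krylov A Ω (s + 1) := by
  rw [Submodule.map_le_iff_le_comap, krylov_le]
  intro i hi
  rw [← Submodule.map_le_iff_le_comap]
  have := (krylov_le (A := A) (Ω := Ω) (s := s + 1)).mp le_rfl (i + 1) (by omega)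
  rwa [pow_succ', Matrix.mul_assoc, matRange, Matrix.mulVecLin_mul, LinearMap.range_comp] at this

theorem krylov_mono {s t : ℕ} (h : s ≤ t) : krylov A Ω s ≤ krylov A Ω t :=
  krylov_le.mpr fun i hi => krylov_le.mp le_rfl i (by omega)

/-- The columns of `[V₀ ⋯ V_{s-1}]` span the Krylov subspace. -/
theorem matRange_Q (L : BlockLanczosRun A Ω N) {s : ℕ} (hs : s ≤ N + 1) :
    matRange (L.Q s) = krylov A Ω s := by
  induction s using Nat.strong_induction_on with
  | _ s ih =>
    rcases s with _ | _ | i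
    · exact le_antisymm (L.matRange_Q_le.mpr (by simp)) (krylov_le.mpr (by simp))
    · refine le_antisymm (L.matRange_Q_le.mpr ?_) (krylov_le.mpr ?_)
      · intro i hi
        obtain rfl : i = 0 := by omega
        rw [L.V_zero.2]
        simpa using (krylov_le (A := A) (Ω := Ω) (s := 1)).mp le_rfl 0 (by omega)
      · intro i hi
        obtain rfl : i = 0 := by omega
        simpa [L.V_zero.2] using L.matRange_Q_le.mp (le_refl (matRange (L.Q 1))) 0 (by omega)
    · have hi : i < N := by omega
      have hK := ih (i + 1) (by omega) (by omega)
      have hV : ∀ j ≤ i, matRange (L.V j) ≤ matRange (L.Q (i + 1)) := fun j hj =>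
        L.matRange_Q_le.mp le_rfl j (by omega)
      have hVK : ∀ j ≤ i, matRange (L.V j) ≤ krylov A Ω (j + 1) := fun j hj => by
        rw [← ih (j + 1) (by omega) (by omega)]
        exact L.matRange_Q_le.mp le_rfl j (by omega)
      have hmul : ∀ {d e : ℕ} (B : Matrix (Fin n) (Fin d) ℝ) (C : Matrix (Fin d) (Fin e) ℝ) v,
          (B * C) *ᵥ v ∈ matRange B := fun B C v =>
        ⟨C *ᵥ v, by rw [Matrix.mulVecLin_apply, Matrix.mulVec_mulVec]⟩
      -- the reorthogonalized block differs from `A Vᵢ` by an element of the previous subspace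
      have hZ : ∀ v, (A * L.V i) *ᵥ v
          - reorth L.V i (lanczosY A L.V L.R i - L.V i * L.M i) *ᵥ v ∈ matRange (L.Q (i + 1)) := by
        intro v
        have h1 : (A * L.V i) *ᵥ v - lanczosY A L.V L.R i *ᵥ v ∈ matRange (L.Q (i + 1)) := by
          rcases i with _ | i
          · simp [lanczosY]
          · simp only [lanczosY, Matrix.sub_mulVec, sub_sub_cancel]
            exact hV i (by omega) (hmul _ _ v)
        have h2 : (∑ j ∈ Finset.range (i + 1), L.V j *
            ((L.V j)ᵀ * (lanczosY A L.V L.R i - L.V i * L.M i))) *ᵥ v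
              ∈ matRange (L.Q (i + 1)) := by
          rw [Matrix.sum_mulVec]
          exact Submodule.sum_mem _ fun j hj =>
            hV j (by simpa [Nat.lt_succ_iff] using hj) (hmul _ _ v)
        have h3 : (L.V i * L.M i) *ᵥ v ∈ matRange (L.Q (i + 1)) := hV i le_rfl (hmul _ _ v)
        have := Submodule.add_mem _ (Submodule.add_mem _ h1 h2) h3
        convert this using 1
        simp only [reorth, Matrix.sub_mulVec]
        abel
      refine le_antisymm (L.matRange_Q_le.mpr ?_) (krylov_le.mpr ?_)
      · intro j hj
        rcases Nat.lt_succ_iff_lt_or_eq.mp hj with h | rfl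
        · exact (hVK j (by omega)).trans (krylov_mono (by omega))
        · rw [(L.V_succ i hi).2]
          rintro _ ⟨v, rfl⟩
          have h1 : (A * L.V i) *ᵥ v ∈ krylov A Ω (i + 1 + 1) := by
            refine map_krylov_le _ ⟨L.V i *ᵥ v, hVK i le_rfl ⟨v, rfl⟩, ?_⟩
            rw [Matrix.mulVecLin_apply, Matrix.mulVec_mulVec]
          have h2 := krylov_mono (A := A) (Ω := Ω) (Nat.le_succ (i + 1)) (hK ▸ hZ v)
          have := Submodule.sub_mem _ h1 h2
          simpa using this
      · have hQ : matRange (L.Q (i + 1)) ≤ matRange (L.Q (i + 1 + 1)) :=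
          L.matRange_Q_le.mpr fun j hj => L.matRange_Q_le.mp le_rfl j (by omega)
        intro j hj
        rcases Nat.lt_succ_iff_lt_or_eq.mp hj with h | rfl
        · refine le_trans ?_ hQ
          rw [hK]
          exact krylov_le.mp le_rfl j h
        · have h1 : matRange (A ^ (i + 1) * Ω) ≤
              (matRange (L.Q (i + 1))).map A.mulVecLin := by
            rw [pow_succ', Matrix.mul_assoc, matRange, Matrix.mulVecLin_mul,
              LinearMap.range_comp, hK]
            exact Submodule.map_mono (krylov_le.mp le_rfl i (by omega))
          refine h1.trans ?_
          rw [Submodule.map_le_iff_le_comap, L.matRange_Q_le]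
          intro j hj
          rcases Nat.lt_succ_iff_lt_or_eq.mp hj with h | rfl
          · rw [← Submodule.map_le_iff_le_comap]
            refine le_trans ?_ hQ
            rw [hK]
            exact (Submodule.map_mono (hVK j h.le)).trans
              ((map_krylov_le _).trans (krylov_mono (by omega)))
          · rintro _ ⟨v, rfl⟩
            rw [Submodule.mem_comap, Matrix.mulVecLin_apply, Matrix.mulVecLin_apply,
              Matrix.mulVec_mulVec]
            have h2 : reorth L.V j (lanczosY A L.V L.R j - L.V j * L.M j) *ᵥ v
                ∈ matRange (L.Q (j + 1 + 1)) := by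
              refine L.matRange_Q_le.mp le_rfl (j + 1) (by omega) ?_
              rw [(L.V_succ j hi).2]
              exact ⟨v, rfl⟩
            have := Submodule.add_mem _ (hQ (hZ v)) h2
            simpa using this

/-- The number of columns of `[V₀ ⋯ V_{s-1}]` is the dimension of the Krylov subspace. -/
theorem card_idx (L : BlockLanczosRun A Ω N) {s : ℕ} (hs : s ≤ N + 1) :
    Fintype.card (L.Idx s) = Module.finrank ℝ (krylov A Ω s) := by
  rw [← L.matRange_Q hs, matRange, LinearMap.finrank_range_of_inj, Module.finrank_fintype_fun_eq_card]
  intro v v' h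
  have := congrArg (fun u => (L.Q s)ᵀ *ᵥ u) h
  simpa [Matrix.mulVecLin_apply, Matrix.mulVec_mulVec, L.transpose_Q_mul_Q hs] using this

/-- The matrix `T_s` is the compression of `A` to the Krylov subspace. -/
theorem T_eq (L : BlockLanczosRun A Ω N) (hA : A.IsSymm) {s : ℕ} (hs : s ≤ N) :
    L.T s = (L.Q s)ᵀ * A * L.Q s := by
  have hon : ∀ i < s, (L.V i)ᵀ * L.V i = 1 := by
    intro i hi
    rcases i with _ | i
    · exact L.V_zero.1
    · exact (L.V_succ i (by omega)).1
  have hne : ∀ i ≤ N, ∀ j ≤ N, i ≠ j → (L.V i)ᵀ * L.V j = 0 := by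
    intro i hi j hj h
    rcases lt_or_gt_of_ne h with h | h
    · exact L.transpose_V_mul_V_of_lt j hj i h
    · have := congrArg transpose (L.transpose_V_mul_V_of_lt i hi j h)
      simpa using this
  have hsymm : ∀ i j, (L.V i)ᵀ * A * L.V j = ((L.V j)ᵀ * A * L.V i)ᵀ := by
    intro i j
    rw [transpose_mul, transpose_mul, transpose_transpose, hA.eq, Matrix.mul_assoc]
  have hdiag : ∀ i < s, (L.V i)ᵀ * A * L.V i = L.M i := by
    intro i hi
    rw [L.M_eq i (by omega)]
    rcases i with _ | i
    · simp [lanczosY, Matrix.mul_assoc]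
    · rw [lanczosY, Matrix.mul_sub, ← Matrix.mul_assoc _ (L.V i),
        hne (i + 1) (by omega) i (by omega) (by omega)]
      simp [Matrix.mul_assoc]
  have hbelow : ∀ j < s, ∀ i ≤ N, j < i → (L.V i)ᵀ * A * L.V j =
      (L.V i)ᵀ * reorth L.V j (lanczosY A L.V L.R j - L.V j * L.M j) := by
    intro j hj i hi hij
    have h1 : (L.V i)ᵀ * lanczosY A L.V L.R j = (L.V i)ᵀ * A * L.V j := by
      rcases j with _ | j
      · simp [lanczosY, Matrix.mul_assoc]
      · rw [lanczosY, Matrix.mul_sub, ← Matrix.mul_assoc _ (L.V j),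
          hne i hi j (by omega) (by omega)]
        simp [Matrix.mul_assoc]
    rw [reorth, Matrix.mul_sub, Matrix.mul_sub, h1, ← Matrix.mul_assoc _ (L.V j),
      hne i hi j (by omega) (by omega), Matrix.mul_sum, Finset.sum_eq_zero]
    · simp
    · intro a ha
      have := Finset.mem_range.mp ha
      rw [← Matrix.mul_assoc, hne i hi a (by omega) (by omega), Matrix.zero_mul]
  have hsub : ∀ j < s, (L.V (j + 1))ᵀ * A * L.V j = L.R j := by
    intro j hj
    rw [hbelow j hj (j + 1) (by omega) (by omega), ← L.R_succ j (by omega)]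
  have hfar : ∀ j < s, ∀ i ≤ N, j + 1 < i → (L.V i)ᵀ * A * L.V j = 0 := by
    intro j hj i hi hij
    rw [hbelow j hj i hi (by omega)]
    ext a b
    have hb : reorth L.V j (lanczosY A L.V L.R j - L.V j * L.M j) *ᵥ Pi.single b 1
        ∈ matRange (L.V (j + 1)) := by
      rw [(L.V_succ j (by omega)).2]
      exact ⟨_, rfl⟩
    obtain ⟨v, hv⟩ := hb
    have h0 : ((L.V i)ᵀ * reorth L.V j (lanczosY A L.V L.R j - L.V j * L.M j)) *ᵥ Pi.single b 1
        = 0 := by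
      rw [← Matrix.mulVec_mulVec, ← hv, Matrix.mulVecLin_apply, Matrix.mulVec_mulVec,
        hne i hi (j + 1) (by omega) (by omega), Matrix.zero_mulVec]
    simpa using congrFun h0 a
  ext ⟨⟨i, hi⟩, a⟩ ⟨⟨j, hj⟩, b⟩
  change _ = ((L.V i)ᵀ * A * L.V j) a b
  simp only [T, Matrix.of_apply]
  split_ifs with h1 h2 h3
  · obtain rfl : j = i := h1
    rw [hdiag j hj]
    rfl
  · obtain rfl : i = j + 1 := h2
    rw [hsub j hj]
    rfl
  · obtain rfl : j = i + 1 := h3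
    rw [hsymm, transpose_apply, hsub i hi]
    rfl
  · change ¬ j = i at h1
    change ¬ i = j + 1 at h2
    change ¬ j = i + 1 at h3
    rcases lt_or_gt_of_ne h1 with h | h
    · rw [hfar j hj i (by omega) (by omega)]
      rfl
    · rw [hsymm, transpose_apply, hfar i hi j (by omega) (by omega)]
      rfl

/-- The indices of the first block. -/
def first (L : BlockLanczosRun A Ω N) {s : ℕ} (hs : 0 < s) (a : Fin (L.w 0)) : L.Idx s :=
  ⟨⟨0, hs⟩, a⟩

/-- The indices of the first `s` blocks among those of the first `s + r` blocks. -/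
def leading (L : BlockLanczosRun A Ω N) (s r : ℕ) (a : L.Idx s) : L.Idx (s + r) :=
  ⟨Fin.castAdd r a.1, a.2⟩

/-- The Lanczos approximation `Q_s f(T_s)_{:,1} R₀` of `f(A) Ω`, where the index `1` stands for
the first block. -/
def matvec (L : BlockLanczosRun A Ω N) (f : ℝ → ℝ) {s : ℕ} (hs : 0 < s) :
    Matrix (Fin n) (Fin ℓ) ℝ :=
  L.Q s * (matFun f (L.T s)).submatrix id (L.first hs) * L.R₀

/-- The Lanczos approximation `R₀ᵀ f(T_s)_{1,1} R₀` of `Ωᵀ f(A) Ω`, where the index `1` stands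
for the first block. -/
def quadForm (L : BlockLanczosRun A Ω N) (f : ℝ → ℝ) {s : ℕ} (hs : 0 < s) :
    Matrix (Fin ℓ) (Fin ℓ) ℝ :=
  (L.R₀)ᵀ * (matFun f (L.T s)).submatrix (L.first hs) (L.first hs) * L.R₀

/-- If the starting block is orthonormal and taken as the first basis block, then `R₀` is the
identity, and the approximation `quadForm` is just the leading block of `f(T_s)`. -/
theorem quadForm_eq (L : BlockLanczosRun A Ω N) (f : ℝ → ℝ) {s : ℕ} (hs : 0 < s)
    (h : ℓ = L.w 0) (hV : Ω = (L.V 0).submatrix id (Fin.cast h)) :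
    L.quadForm f hs = (matFun f (L.T s)).submatrix (fun a => L.first hs (Fin.cast h a))
      (fun a => L.first hs (Fin.cast h a)) := by
  have h1 : L.R₀ = (1 : Matrix (Fin (L.w 0)) (Fin (L.w 0)) ℝ).submatrix id (Fin.cast h) := by
    have h2 : (L.V 0)ᵀ * (L.V 0).submatrix id (Fin.cast h)
        = ((L.V 0)ᵀ * L.V 0).submatrix id (Fin.cast h) := rfl
    rw [L.V_zero.1] at h2
    exact L.R_zero.trans ((congrArg (fun B => (L.V 0)ᵀ * B) hV).trans h2)
  have h2 : ∀ D : Matrix (Fin (L.w 0)) (Fin (L.w 0)) ℝ,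
      (L.R₀)ᵀ * D * L.R₀ = D.submatrix (Fin.cast h) (Fin.cast h) := by
    intro D
    ext a b
    simp [h1, Matrix.mul_apply, Matrix.one_apply]
  rw [quadForm, h2]
  rfl

/-- The leading principal submatrix of `f(T_{s+r})` that belongs to the first `s` blocks. It
has `dim K_s(A, Ω)` rows and columns by `card_idx`. -/
def krylovAwareX (L : BlockLanczosRun A Ω N) (f : ℝ → ℝ) (s r : ℕ) :
    Matrix (L.Idx s) (L.Idx s) ℝ :=
  (matFun f (L.T (s + r))).submatrix (L.leading s r) (L.leading s r)

end BlockLanczosRun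

/-- `inf_p sup_{x ∈ [a,b]} |f(x) - p(x)|` over the real polynomials `p` of degree at most `d`, as
an extended nonnegative number (it is infinite if `f` is unbounded on the interval). -/
def bestPolyError (f : ℝ → ℝ) (d : ℕ) (a b : ℝ) : ENNReal :=
  ⨅ p : {p : ℝ[X] // p.natDegree ≤ d}, ⨆ x ∈ Set.Icc a b, ENNReal.ofReal |f x - p.1.eval x|

end

/-! Write `F = f(A)`, `Q = Q_s`, `G = Qᵀ F Q`. The columns of `K` are combinations of the columns of
`Q'_s`, hence lie in the Krylov space spanned by `Q` (`matRange_matvec_le`). So `W Xk' Wᵀ = Q D Qᵀ`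
for some `D` of rank at most `k`. Nothing else about the randomized SVD matters, in particular not
how well its core matrix approximates `Wᵀ F W`.

By Pythagoras (`frobNorm_sub_conj_sq`), `‖F - Q Y Qᵀ‖²` is a constant plus `‖G - Y‖²`. If `Y`
truncates `X` instead of `G`, Eckart–Young and two triangle inequalities give `‖G - Y‖ ≤ ‖G - D‖ +
2‖G - X‖`, and the excess survives the passage back to `F` (`frobNorm_sub_conj_truncated_le`).

It remains to bound `‖G - X‖`. For a polynomial `p` of degree at most `2r + 1` the leading block of
`p(T_{s+r})` equals `Qᵀ p(A) Q` (`compress_aeval_eq`). Hence only the compressions of `f - p` at `A`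
and at `T_{s+r}` remain. Each costs at most `√(ℓ s)` times the largest error on the spectra, which
lie in the given interval. The constant is `4 = 2 · 2`. -/

/-! ### Frobenius norm and orthonormal columns -/

section FrobeniusLemmas

variable {m c e : Type*} [Fintype m] [Fintype c] [Fintype e]

theorem frobNorm_nonneg (B : Matrix m c ℝ) : 0 ≤ frobNorm B := by
  rw [frobNorm_eq]; positivity

theorem frobNorm_sq (B : Matrix m c ℝ) : frobNorm B ^ 2 = ∑ i, ∑ j, B i j ^ 2 := by
  rw [frobNorm_eq, Real.sq_sqrt (by positivity)]

theorem frobNorm_sq_eq_trace (B : Matrix m c ℝ) : frobNorm B ^ 2 = (Bᵀ * B).trace := by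
  rw [frobNorm_sq, Finset.sum_comm]
  simp [Matrix.trace, Matrix.mul_apply, sq]

section
attribute [local instance] Matrix.frobeniusNormedAddCommGroup

theorem frobNorm_add_le (B C : Matrix m c ℝ) : frobNorm (B + C) ≤ frobNorm B + frobNorm C :=
  norm_add_le B C

theorem frobNorm_sub_le (B C : Matrix m c ℝ) : frobNorm (B - C) ≤ frobNorm B + frobNorm C :=
  norm_sub_le B C

end

theorem frobNorm_add_sq {B C : Matrix m c ℝ} (h : (Bᵀ * C).trace = 0) :
    frobNorm (B + C) ^ 2 = frobNorm B ^ 2 + frobNorm C ^ 2 := by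
  have h' : (Cᵀ * B).trace = 0 := by
    rw [← Matrix.trace_transpose, transpose_mul, transpose_transpose, h]
  simp only [frobNorm_sq_eq_trace, transpose_add, Matrix.add_mul, Matrix.mul_add,
    Matrix.trace_add, h, h']
  ring

variable [DecidableEq c]

/-- Multiplication by a matrix with orthonormal columns preserves the Frobenius norm. -/
theorem frobNorm_mul_of_orthonormal {S : Matrix m c ℝ} (hS : Sᵀ * S = 1) (Y : Matrix c e ℝ) :
    frobNorm (S * Y) ^ 2 = frobNorm Y ^ 2 := by
  rw [frobNorm_sq_eq_trace, frobNorm_sq_eq_trace, transpose_mul, Matrix.mul_assoc,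
    ← Matrix.mul_assoc Sᵀ, hS, Matrix.one_mul]

/-- The residual `Y - S Sᵀ Y` is orthogonal to everything of the form `S * Z'`. The case `Z = 0`
shows that `Sᵀ` is a contraction. -/
theorem frobNorm_sub_mul_sq {S : Matrix m c ℝ} (hS : Sᵀ * S = 1) (Y : Matrix m e ℝ)
    (Z : Matrix c e ℝ) :
    frobNorm (Y - S * Z) ^ 2 = frobNorm (Y - S * (Sᵀ * Y)) ^ 2 + frobNorm (Sᵀ * Y - Z) ^ 2 := by
  rw [← frobNorm_mul_of_orthonormal hS (Sᵀ * Y - Z), ← frobNorm_add_sq]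
  · rw [Matrix.mul_sub]; congr 2; abel
  · rw [← Matrix.mul_assoc, transpose_sub, Matrix.sub_mul, transpose_mul, Matrix.mul_assoc _ Sᵀ S,
      hS, transpose_mul, transpose_transpose, Matrix.mul_one, sub_self, Matrix.zero_mul,
      Matrix.trace_zero]

theorem frobNorm_transpose_mul_le {S : Matrix m c ℝ} (hS : Sᵀ * S = 1) (Y : Matrix m e ℝ) :
    frobNorm (Sᵀ * Y) ≤ frobNorm Y := by
  have h := frobNorm_sub_mul_sq hS Y 0
  rw [Matrix.mul_zero, sub_zero, sub_zero] at h
  exact le_of_sq_le_sq (by nlinarith [sq_nonneg (frobNorm (Y - S * (Sᵀ * Y)))])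
    (frobNorm_nonneg _)

theorem frobNorm_transpose (B : Matrix m e ℝ) : frobNorm Bᵀ = frobNorm B := by
  rw [frobNorm_eq, frobNorm_eq, Finset.sum_comm]
  rfl

/-- Pythagoras' theorem for the approximations of `F` with range and corange in the span of the
orthonormal columns of `Q`. -/
theorem frobNorm_sub_conj_sq {Q : Matrix m c ℝ} (hQ : Qᵀ * Q = 1) (F : Matrix m m ℝ)
    (Y : Matrix c c ℝ) :
    frobNorm (F - Q * Y * Qᵀ) ^ 2 =
      frobNorm (F - Q * (Qᵀ * F * Q) * Qᵀ) ^ 2 + frobNorm (Qᵀ * F * Q - Y) ^ 2 := by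
  -- Project the columns, then transpose and project the rows. Only the last term depends on `Y`, so
  -- evaluating at `Qᵀ F Q` identifies the other two.
  have key : ∀ Y : Matrix c c ℝ, frobNorm (F - Q * Y * Qᵀ) ^ 2 =
      frobNorm (F - Q * (Qᵀ * F)) ^ 2 + (frobNorm (Fᵀ * Q - Q * (Qᵀ * (Fᵀ * Q))) ^ 2 +
        frobNorm (Qᵀ * F * Q - Y) ^ 2) := by
    intro Y
    rw [Matrix.mul_assoc, frobNorm_sub_mul_sq hQ, ← frobNorm_transpose (Qᵀ * F - Y * Qᵀ)]
    have h : (Qᵀ * F - Y * Qᵀ)ᵀ = Fᵀ * Q - Q * Yᵀ := by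
      simp [transpose_sub, transpose_mul]
    rw [h, frobNorm_sub_mul_sq hQ (Fᵀ * Q), ← frobNorm_transpose (Qᵀ * F * Q - Y)]
    simp [transpose_sub, transpose_mul, Matrix.mul_assoc]
  rw [key, key (Qᵀ * F * Q)]
  have h0 : frobNorm (0 : Matrix c c ℝ) ^ 2 = 0 := by simp [frobNorm_sq]
  rw [sub_self, h0]
  ring

theorem frobNorm_one_sq_of_orthonormal {S : Matrix m c ℝ} (hS : Sᵀ * S = 1) :
    frobNorm S ^ 2 = Fintype.card c := by
  rw [frobNorm_sq_eq_trace, hS, Matrix.trace_one]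

/-- `S Sᵀ` is the orthogonal projector onto the range of `S`. This turns each inclusion of ranges
below into a factorization. -/
theorem mul_transpose_mul_of_matRange_le {S : Matrix m c ℝ} (hS : Sᵀ * S = 1) {Y : Matrix m e ℝ}
    (h : matRange Y ≤ matRange S) : S * (Sᵀ * Y) = Y := by
  classical
  refine Matrix.ext_of_mulVec_single fun b => ?_
  obtain ⟨v, hv⟩ := h ⟨Pi.single b 1, rfl⟩
  rw [Matrix.mulVecLin_apply, Matrix.mulVecLin_apply] at hv
  rw [← Matrix.mulVec_mulVec, ← Matrix.mulVec_mulVec, ← hv, Matrix.mulVec_mulVec v, hS,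
    Matrix.one_mulVec]

end FrobeniusLemmas

/-! ### Eckart–Young theorem in the Frobenius norm -/

section EckartYoung

theorem exists_orthonormal_matRange {m e : Type*} [Fintype m] [Fintype e] (D : Matrix m e ℝ) :
    ∃ P : Matrix m (Fin D.rank) ℝ, Pᵀ * P = 1 ∧ matRange P = matRange D := by
  -- The range is transported to `EuclideanSpace`, where the inner product is available.
  let K : Submodule ℝ (EuclideanSpace ℝ m) :=
    (matRange D).map (WithLp.linearEquiv 2 ℝ (m → ℝ)).symm.toLinearMap
  have hK : Module.finrank ℝ K = D.rank := LinearEquiv.finrank_map_eq _ _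
  let b := (stdOrthonormalBasis ℝ K).reindex (finCongr hK)
  refine ⟨Matrix.of fun x a => (b a : EuclideanSpace ℝ m) x, ?_, ?_⟩
  · ext i j
    have h := (orthonormal_iff_ite.mp b.orthonormal) i j
    rw [Submodule.coe_inner, PiLp.inner_apply] at h
    simp only [Matrix.mul_apply, transpose_apply, Matrix.of_apply, Matrix.one_apply]
    rw [← h]
    exact Finset.sum_congr rfl fun x _ => by simp [mul_comm]
  · have h1 : Submodule.span ℝ (Set.range fun a => (b a : EuclideanSpace ℝ m)) = K := by
      have := b.toBasis.span_eq
      have h2 := congrArg (Submodule.map K.subtype) this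
      rw [Submodule.map_span, Submodule.map_top, Submodule.range_subtype, ← Set.range_comp] at h2
      simpa [Function.comp_def] using h2
    have h3 := congrArg (Submodule.map (WithLp.linearEquiv 2 ℝ (m → ℝ)).toLinearMap) h1
    rw [Submodule.map_span, ← Set.range_comp] at h3
    rw [matRange, Matrix.range_mulVecLin]
    refine Eq.trans ?_ (h3.trans ?_)
    · rfl
    · rw [← Submodule.map_comp]
      simp

/-- A linear functional with nonincreasing coefficients on the vectors with entries in `[0, 1]`
and sum at most `k` is largest at the indicator of the first `k` indices. -/
theorem sum_mul_le_sum_ite {d k : ℕ} {a c : Fin d → ℝ} (ha : Antitone a) (ha0 : ∀ i, 0 ≤ a i)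
    (hc0 : ∀ i, 0 ≤ c i) (hc1 : ∀ i, c i ≤ 1) (hc : ∑ i, c i ≤ k) :
    ∑ i, a i * c i ≤ ∑ i : Fin d, if i.1 < k then a i else 0 := by
  rcases le_or_gt d k with h | h
  · refine Finset.sum_le_sum fun i _ => ?_
    rw [if_pos (by omega)]
    nlinarith [ha0 i, hc1 i]
  -- Pivot at the first discarded coefficient: `a i - τ` is nonnegative before index `k` and
  -- nonpositive from there on, so the bounds `0 ≤ c i ≤ 1` suffice term by term. The bound on the
  -- sum enters only through `τ * ∑ c i ≤ k * τ`.
  · set τ := a ⟨k, h⟩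
    have h1 : ∑ i, (a i - τ) * c i ≤ ∑ i : Fin d, if i.1 < k then a i - τ else 0 := by
      refine Finset.sum_le_sum fun i _ => ?_
      split_ifs with hi
      · have : τ ≤ a i := ha (show i ≤ ⟨k, h⟩ from hi.le)
        nlinarith [hc1 i]
      · have : a i ≤ τ := ha (show (⟨k, h⟩ : Fin d) ≤ i from not_lt.mp hi)
        nlinarith [hc0 i]
    have h2 : (∑ i : Fin d, if i.1 < k then a i - τ else 0) =
        (∑ i : Fin d, if i.1 < k then a i else 0) - k * τ := by
      have h3 : (Finset.univ.filter fun i : Fin d => i.1 < k).card = k := by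
        rw [Fin.card_filter_val_lt]; omega
      rw [← Finset.sum_filter, ← Finset.sum_filter, Finset.sum_sub_distrib, Finset.sum_const, h3,
        nsmul_eq_mul]
    have h4 : ∑ i, (a i - τ) * c i = ∑ i, a i * c i - τ * ∑ i, c i := by
      simp only [sub_mul, Finset.sum_sub_distrib, Finset.mul_sum]
    nlinarith [mul_le_mul_of_nonneg_left hc (ha0 ⟨k, h⟩)]

variable {m e : Type*} [Fintype m] [Fintype e]

theorem frobNorm_mul_diagonal_sq {d : Type*} [Fintype d] [DecidableEq d] (B : Matrix m d ℝ)
    (σ : d → ℝ) : frobNorm (B * diagonal σ) ^ 2 = ∑ i, σ i ^ 2 * ∑ x, B x i ^ 2 := by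
  rw [frobNorm_sq, Finset.sum_comm]
  simp [Matrix.mul_diagonal, mul_pow, Finset.mul_sum, mul_comm]

theorem frobNorm_mul_transpose_of_orthonormal {d : Type*} [Fintype d] [DecidableEq d]
    {V : Matrix e d ℝ} (hV : Vᵀ * V = 1) (Y : Matrix m d ℝ) :
    frobNorm (Y * Vᵀ) ^ 2 = frobNorm Y ^ 2 := by
  rw [← frobNorm_transpose, transpose_mul, transpose_transpose, frobNorm_mul_of_orthonormal hV,
    frobNorm_transpose]

/-- The Eckart–Young theorem: a truncated singular value decomposition is a best approximation
of rank at most `k` in the Frobenius norm. -/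
theorem IsTruncatedSVD.frobNorm_sub_le {k : ℕ} {B C : Matrix m e ℝ} (h : IsTruncatedSVD k B C)
    {D : Matrix m e ℝ} (hD : D.rank ≤ k) : frobNorm (B - C) ≤ frobNorm (B - D) := by
  obtain ⟨d, U, V, σ, hU, hV, hσ, hσ0, hB, hC⟩ := h
  obtain ⟨P, hP, hPD⟩ := exists_orthonormal_matRange D
  have hDP : P * (Pᵀ * D) = D := mul_transpose_mul_of_matRange_le hP hPD.ge
  have hBC : frobNorm (B - C) ^ 2 =
      ∑ i, σ i ^ 2 - ∑ i : Fin d, if i.1 < k then σ i ^ 2 else 0 := by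
    have h1 : B - C = U * (diagonal (fun i : Fin d => if i.1 < k then 0 else σ i) * Vᵀ) := by
      rw [hB, hC, ← Matrix.sub_mul, ← Matrix.mul_sub, diagonal_sub, Matrix.mul_assoc]
      congr 3
      ext i
      split_ifs <;> simp
    rw [h1, frobNorm_mul_of_orthonormal hU, frobNorm_mul_transpose_of_orthonormal hV,
      ← Matrix.one_mul (diagonal _), frobNorm_mul_diagonal_sq, ← Finset.sum_sub_distrib]
    refine Finset.sum_congr rfl fun i _ => ?_
    split_ifs <;> simp [Matrix.one_apply]
  have hB2 : frobNorm B ^ 2 = ∑ i, σ i ^ 2 := by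
    rw [hB, Matrix.mul_assoc, frobNorm_mul_of_orthonormal hU,
      frobNorm_mul_transpose_of_orthonormal hV, ← Matrix.one_mul (diagonal _),
      frobNorm_mul_diagonal_sq]
    simp [Matrix.one_apply]
  -- The left side is `∑ σ i ^ 2 * c i`, where `c i` is the squared norm of `Pᵀ` times column `i` of
  -- `U`. Each `c i` is at most `1`, and their sum is `‖Uᵀ P‖² ≤ ‖P‖² = rank D ≤ k`.
  have hPB : frobNorm (Pᵀ * B) ^ 2 ≤ ∑ i : Fin d, if i.1 < k then σ i ^ 2 else 0 := by
    rw [hB, ← Matrix.mul_assoc, frobNorm_mul_transpose_of_orthonormal hV, ← Matrix.mul_assoc,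
      frobNorm_mul_diagonal_sq]
    refine sum_mul_le_sum_ite (fun i j hij => pow_le_pow_left₀ (hσ0 _) (hσ hij) 2)
      (fun i => sq_nonneg _) (fun i => by positivity) (fun i => ?_) ?_
    -- Multiplying by a unit column writes a column norm as a Frobenius norm, so that the
    -- contraction bound for `Pᵀ` applies.
    · have hcol : ∀ {a : Type _} [Fintype a] (Y : Matrix a (Fin d) ℝ),
          ∑ x, Y x i ^ 2 = frobNorm (Y * Matrix.of fun (j : Fin d) (_ : Unit) =>
            if j = i then (1 : ℝ) else 0) ^ 2 := by
        intro a _ Y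
        simp [frobNorm_sq, Matrix.mul_apply]
      rw [hcol, Matrix.mul_assoc]
      refine (pow_le_pow_left₀ (frobNorm_nonneg _) (frobNorm_transpose_mul_le hP _) 2).trans ?_
      rw [frobNorm_mul_of_orthonormal hU, frobNorm_sq]
      simp
    · have h1 : ∑ i, ∑ x, (Pᵀ * U) x i ^ 2 = frobNorm (Uᵀ * P) ^ 2 := by
        rw [← frobNorm_transpose, transpose_mul, transpose_transpose, frobNorm_sq,
          Finset.sum_comm]
      rw [h1]
      refine (pow_le_pow_left₀ (frobNorm_nonneg _) (frobNorm_transpose_mul_le hU _) 2).trans ?_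
      rw [frobNorm_one_sq_of_orthonormal hP, Fintype.card_fin]
      exact_mod_cast hD
  -- Together these give `‖B - D‖² ≥ ‖B - P Pᵀ B‖² = ‖B‖² - ‖Pᵀ B‖²`.
  have h1 := frobNorm_sub_mul_sq hP B (Pᵀ * D)
  have h2 := frobNorm_sub_mul_sq hP B 0
  rw [hDP] at h1
  rw [Matrix.mul_zero, sub_zero, sub_zero] at h2
  exact le_of_sq_le_sq (by nlinarith [sq_nonneg (frobNorm (Pᵀ * B - Pᵀ * D))])
    (frobNorm_nonneg _)

theorem IsTruncatedSVD.rank_le {k : ℕ} {B C : Matrix m e ℝ} (h : IsTruncatedSVD k B C) :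
    C.rank ≤ k := by
  obtain ⟨d, U, V, σ, -, -, -, -, -, hC⟩ := h
  rw [hC]
  refine (Matrix.rank_mul_le_left _ _).trans ((Matrix.rank_mul_le_right _ _).trans ?_)
  rw [Matrix.rank_diagonal, Fintype.card_subtype]
  calc _ ≤ (Finset.univ.filter fun i : Fin d => i.1 < k).card := by
        refine Finset.card_le_card fun i hi => ?_
        simp only [Finset.mem_filter, Finset.mem_univ, true_and] at hi ⊢
        by_contra hik
        exact hi (if_neg hik)
    _ ≤ k := by rw [Fin.card_filter_val_lt]; omega

end EckartYoung

/-! ### Functions and spectra of compressed symmetric matrices -/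

section MatrixFunctions

variable {m c : Type*} [Fintype m] [DecidableEq m] [Fintype c] [DecidableEq c]

theorem Matrix.IsSymm.exists_diagonalization {B : Matrix m m ℝ} (hB : B.IsSymm) :
    ∃ (U : Matrix m m ℝ) (μ : m → ℝ), U * Uᵀ = 1 ∧ B = U * diagonal μ * Uᵀ ∧
      ∀ i, μ i ∈ spectrum ℝ B := by
  have hH : B.IsHermitian := by
    rw [Matrix.IsHermitian, conjTranspose_eq_transpose_of_trivial, hB.eq]
  refine ⟨hH.eigenvectorUnitary, hH.eigenvalues, ?_, ?_, hH.eigenvalues_mem_spectrum_real⟩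
  · have := Unitary.coe_mul_star_self hH.eigenvectorUnitary
    rwa [Unitary.coe_star, star_eq_conjTranspose, conjTranspose_eq_transpose_of_trivial] at this
  · have := hH.spectral_theorem
    rw [Unitary.conjStarAlgAut_apply, star_eq_conjTranspose,
      conjTranspose_eq_transpose_of_trivial] at this
    exact this

theorem aeval_eq_matFun {B : Matrix m m ℝ} (hB : B.IsSymm) (p : ℝ[X]) :
    aeval B p = matFun p.eval B := by
  have hB' : IsSelfAdjoint B := by
    show star _ = _
    rw [star_eq_conjTranspose, conjTranspose_eq_transpose_of_trivial, hB.eq]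
  exact (cfc_polynomial p B hB').symm

/-- If `f` is within `ε` of the polynomial `p` on the spectrum of `B`, then compressions of `f(B)`
and `p(B)` to a subspace of dimension `d` are within `√d ε`. -/
theorem frobNorm_compress_matFun_sub_aeval_le {B : Matrix m m ℝ} (hB : B.IsSymm) (f : ℝ → ℝ)
    (p : ℝ[X]) {ε : ℝ} (hε : 0 ≤ ε) (h : ∀ x ∈ spectrum ℝ B, |f x - p.eval x| ≤ ε)
    {S : Matrix m c ℝ} (hS : Sᵀ * S = 1) :
    frobNorm (Sᵀ * (matFun f B - aeval B p) * S) ≤ √(Fintype.card c) * ε := by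
  obtain ⟨U, μ, hU, hUB, hμ⟩ := hB.exists_diagonalization
  have hU' : (Uᵀ)ᵀ * Uᵀ = 1 := by rwa [transpose_transpose]
  have hd : matFun f B - aeval B p = U * diagonal (fun i => f (μ i) - p.eval (μ i)) * Uᵀ := by
    rw [aeval_eq_matFun hB, hUB, matFun_eq _ _ hU, matFun_eq _ _ hU, ← Matrix.sub_mul,
      ← Matrix.mul_sub, diagonal_sub]
  rw [hd, Matrix.mul_assoc]
  -- Dropping `Sᵀ` and the left factor `U` leaves a diagonal matrix of errors acting on `Uᵀ S`,
  -- whose squared norm is the number of columns of `S`.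
  refine (frobNorm_transpose_mul_le hS _).trans (le_of_sq_le_sq ?_ (by positivity))
  have hU2 : Uᵀ * U = 1 := mul_eq_one_comm.mp hU
  rw [Matrix.mul_assoc U, Matrix.mul_assoc, Matrix.mul_assoc, frobNorm_mul_of_orthonormal hU2, mul_pow,
    Real.sq_sqrt (by positivity), ← frobNorm_one_sq_of_orthonormal hS,
    ← frobNorm_mul_of_orthonormal hU' S, frobNorm_sq, frobNorm_sq, Finset.sum_mul]
  refine Finset.sum_le_sum fun i _ => ?_
  rw [Finset.sum_mul]
  refine Finset.sum_le_sum fun j _ => ?_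
  rw [diagonal_mul, mul_pow, mul_comm]
  exact mul_le_mul_of_nonneg_left (sq_le_sq' (by linarith [abs_le.mp (h _ (hμ i))])
    (abs_le.mp (h _ (hμ i))).2) (sq_nonneg _)

/-- The eigenvalues of a compression of `B` lie between the extreme eigenvalues of `B`. -/
theorem spectrum_compress_subset_Icc {B : Matrix m m ℝ} (hB : B.IsSymm) {a b : ℝ}
    (h : spectrum ℝ B ⊆ Set.Icc a b) {S : Matrix m c ℝ} (hS : Sᵀ * S = 1) :
    spectrum ℝ (Sᵀ * B * S) ⊆ Set.Icc a b := by
  obtain ⟨U, μ, hU, hUB, hμ⟩ := hB.exists_diagonalization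
  have hU' : (Uᵀ)ᵀ * Uᵀ = 1 := by rwa [transpose_transpose]
  intro τ hτ
  rw [← Matrix.spectrum_toLin', ← Module.End.hasEigenvalue_iff_mem_spectrum] at hτ
  obtain ⟨v, hv⟩ := hτ.exists_hasEigenvector
  have hv1 : (Sᵀ * B * S) *ᵥ v = τ • v := hv.apply_eq_smul
  have hv0 : v ≠ 0 := hv.2
  have hpos : 0 < v ⬝ᵥ v := by simpa using Matrix.dotProduct_star_self_pos_iff.mpr hv0
  -- Rayleigh quotient: `y` has the same length as the eigenvector `v`, and `τ ‖v‖² = ∑ μ i * y i ^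
  -- 2` is a weighted sum of eigenvalues of `B`.
  set y := (Uᵀ * S) *ᵥ v with hy
  have hyy : y ⬝ᵥ y = v ⬝ᵥ v := by
    rw [hy, Matrix.dotProduct_mulVec, Matrix.vecMul_mulVec, transpose_mul, Matrix.mul_assoc,
      ← Matrix.mul_assoc _ Uᵀ S, hU', Matrix.one_mul, hS, Matrix.vecMul_one]
  have hBy : y ⬝ᵥ (diagonal μ *ᵥ y) = τ * (v ⬝ᵥ v) := by
    have : Sᵀ * B * S = (Uᵀ * S)ᵀ * (diagonal μ * (Uᵀ * S)) := by
      rw [hUB]; simp [transpose_mul, Matrix.mul_assoc]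
    rw [← smul_eq_mul, ← dotProduct_smul, ← hv1, this, ← Matrix.mulVec_mulVec,
      ← Matrix.mulVec_mulVec, Matrix.dotProduct_mulVec v, Matrix.vecMul_transpose]
  have e1 : y ⬝ᵥ (diagonal μ *ᵥ y) = ∑ i, μ i * y i ^ 2 := by
    simp only [dotProduct, Matrix.mulVec_diagonal]
    exact Finset.sum_congr rfl fun i _ => by ring
  have e2 : v ⬝ᵥ v = ∑ i, y i ^ 2 := by
    rw [← hyy]; simp only [dotProduct, sq]
  have hlow : a * (v ⬝ᵥ v) ≤ τ * (v ⬝ᵥ v) := by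
    rw [← hBy, e1, e2, Finset.mul_sum]
    exact Finset.sum_le_sum fun i _ => mul_le_mul_of_nonneg_right (h (hμ i)).1 (sq_nonneg _)
  have hupp : τ * (v ⬝ᵥ v) ≤ b * (v ⬝ᵥ v) := by
    rw [← hBy, e1, e2, Finset.mul_sum]
    exact Finset.sum_le_sum fun i _ => mul_le_mul_of_nonneg_right (h (hμ i)).2 (sq_nonneg _)
  exact ⟨le_of_mul_le_mul_right hlow hpos, le_of_mul_le_mul_right hupp hpos⟩

end MatrixFunctions

/-! ### Polynomial exactness of block-Lanczos -/

/-- Source of the factor `ℓ s` under the square root: this dimension is the number of columns of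
`Q_s`. -/
theorem finrank_krylov_le {n ℓ : ℕ} (A : Matrix (Fin n) (Fin n) ℝ) (Ω : Matrix (Fin n) (Fin ℓ) ℝ)
    (s : ℕ) : Module.finrank ℝ (krylov A Ω s) ≤ ℓ * s := by
  have := LinearMap.finrank_range_le
    (Matrix.of fun (x : Fin n) (c : Fin s × Fin ℓ) => (A ^ (c.1 : ℕ) * Ω) x c.2).mulVecLin
  rw [Module.finrank_fintype_fun_eq_card, Fintype.card_prod, Fintype.card_fin, Fintype.card_fin,
    mul_comm] at this
  exact this

namespace BlockLanczosRun

variable {n ℓ : ℕ} {A : Matrix (Fin n) (Fin n) ℝ} {Ω : Matrix (Fin n) (Fin ℓ) ℝ} {N : ℕ}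

/-- The matrix that selects the first `s` blocks among the first `s + r` blocks. -/
def leadingSelector (L : BlockLanczosRun A Ω N) (s r : ℕ) :
    Matrix (L.Idx (s + r)) (L.Idx s) ℝ :=
  (1 : Matrix (L.Idx (s + r)) (L.Idx (s + r)) ℝ).submatrix id (L.leading s r)

variable (L : BlockLanczosRun A Ω N) (s r : ℕ)

theorem mul_leadingSelector {m : Type*} (B : Matrix m (L.Idx (s + r)) ℝ) :
    B * L.leadingSelector s r = B.submatrix id (L.leading s r) := by
  rw [leadingSelector]
  ext i j
  simp [Matrix.mul_apply, Matrix.one_apply]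

theorem transpose_leadingSelector_mul {m : Type*} (B : Matrix (L.Idx (s + r)) m ℝ) :
    (L.leadingSelector s r)ᵀ * B = B.submatrix (L.leading s r) id := by
  rw [leadingSelector]
  ext i j
  simp [Matrix.mul_apply, Matrix.one_apply]

theorem leading_injective : Function.Injective (L.leading s r) := by
  rintro ⟨i, a⟩ ⟨j, b⟩ h
  rw [leading, leading, Sigma.mk.injEq] at h
  obtain ⟨h1, h2⟩ := h
  obtain rfl : i = j := by simpa using h1
  obtain rfl : a = b := by simpa using h2
  rfl

theorem transpose_leadingSelector_mul_self :
    (L.leadingSelector s r)ᵀ * L.leadingSelector s r = 1 := by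
  rw [transpose_leadingSelector_mul, leadingSelector, Matrix.submatrix_submatrix]
  exact Matrix.submatrix_one _ (L.leading_injective s r)

theorem krylovAwareX_eq (f : ℝ → ℝ) :
    L.krylovAwareX f s r =
      (L.leadingSelector s r)ᵀ * matFun f (L.T (s + r)) * L.leadingSelector s r := by
  rw [mul_leadingSelector, transpose_leadingSelector_mul, Matrix.submatrix_submatrix]
  rfl

theorem Q_add_mul_leadingSelector : L.Q (s + r) * L.leadingSelector s r = L.Q s := by
  rw [mul_leadingSelector]
  rfl

variable {s r}

theorem matRange_pow_mul_Q_le (hs : s ≤ N + 1) (j : ℕ) :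
    matRange (A ^ j * L.Q s) ≤ krylov A Ω (s + j) := by
  induction j with
  | zero => simpa using (L.matRange_Q hs).le
  | succ j ih =>
    rw [pow_succ', Matrix.mul_assoc, matRange, Matrix.mulVecLin_mul, LinearMap.range_comp]
    exact (Submodule.map_mono ih).trans (map_krylov_le _)

/-- As long as `j ≤ r`, the columns of `A ^ j * L.Q s` stay in the range of `Q_{s+r}`. The projector
onto that range can therefore be inserted after each multiplication by `A`, which turns `A` into its
compression `T_{s+r}`. -/
theorem pow_mul_Q (hA : A.IsSymm) (hN : s + r ≤ N) {j : ℕ} (hj : j ≤ r) :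
    A ^ j * L.Q s = L.Q (s + r) * (L.T (s + r) ^ j * L.leadingSelector s r) := by
  induction j with
  | zero => simp [Q_add_mul_leadingSelector]
  | succ j ih =>
    have hle : matRange (A ^ (j + 1) * L.Q s) ≤ matRange (L.Q (s + r)) := by
      rw [L.matRange_Q (by omega)]
      exact (L.matRange_pow_mul_Q_le (by omega) _).trans (krylov_mono (by omega))
    rw [← mul_transpose_mul_of_matRange_le (L.transpose_Q_mul_Q (by omega)) hle, pow_succ',
      Matrix.mul_assoc A, ih (by omega), pow_succ' (L.T (s + r))]
    have hT : L.T (s + r) * L.T (s + r) ^ j * L.leadingSelector s r =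
        (L.Q (s + r))ᵀ * A * L.Q (s + r) * (L.T (s + r) ^ j * L.leadingSelector s r) := by
      rw [← L.T_eq hA hN, Matrix.mul_assoc]
    rw [hT]
    simp only [Matrix.mul_assoc]

/-- The compression of `p(A)` to the span of the first `s` blocks is the leading submatrix of
`p(T_{s+r})` if `p` has degree at most `2r + 1`. -/
theorem compress_aeval_eq (hA : A.IsSymm) (hN : s + r ≤ N) {p : ℝ[X]}
    (hp : p.natDegree ≤ 2 * r + 1) :
    (L.Q s)ᵀ * aeval A p * L.Q s =
      (L.leadingSelector s r)ᵀ * aeval (L.T (s + r)) p * L.leadingSelector s r := by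
  have hpow : ∀ i < 2 * r + 2, (L.Q s)ᵀ * A ^ i * L.Q s =
      (L.leadingSelector s r)ᵀ * L.T (s + r) ^ i * L.leadingSelector s r := by
    intro i hi
    rcases i with _ | i
    · simp [transpose_leadingSelector_mul_self, L.transpose_Q_mul_Q (show s ≤ N + 1 by omega)]
    -- Up to `r` powers of `A` are absorbed on each side. One more factor is left in the middle,
    -- where `Qᵀ A Q = T` holds by `T_eq`; hence the degree `2r + 1`.
    · obtain ⟨a, b, ha, hb, rfl⟩ : ∃ a b, a ≤ r ∧ b ≤ r ∧ i = a + b :=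
        ⟨min i r, i - min i r, by omega, by omega, by omega⟩
      have hT : (L.T (s + r))ᵀ = L.T (s + r) := by
        rw [L.T_eq hA hN]; simp [transpose_mul, hA.eq, Matrix.mul_assoc]
      have h1 : (L.Q s)ᵀ * A ^ a = (L.leadingSelector s r)ᵀ * (L.T (s + r) ^ a *
          (L.Q (s + r))ᵀ) := by
        have := congrArg transpose (L.pow_mul_Q hA hN ha)
        simpa only [transpose_mul, transpose_pow, hA.eq, hT, Matrix.mul_assoc] using this
      calc (L.Q s)ᵀ * A ^ (a + b + 1) * L.Q s
          = ((L.Q s)ᵀ * A ^ a) * (A * (A ^ b * L.Q s)) := by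
            rw [add_assoc, pow_add, pow_succ']; simp only [Matrix.mul_assoc]
        _ = (L.leadingSelector s r)ᵀ * (L.T (s + r) ^ a * (((L.Q (s + r))ᵀ * A * L.Q (s + r)) *
              L.T (s + r) ^ b)) * L.leadingSelector s r := by
            rw [h1, L.pow_mul_Q hA hN hb]; simp only [Matrix.mul_assoc]
        _ = _ := by rw [← L.T_eq hA hN, ← pow_succ', ← pow_add, add_assoc]
  rw [aeval_eq_sum_range' (Nat.lt_succ_of_le hp), aeval_eq_sum_range' (Nat.lt_succ_of_le hp)]
  simp only [Matrix.mul_sum, Matrix.sum_mul, Matrix.mul_smul, Matrix.smul_mul]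
  exact Finset.sum_congr rfl fun i hi => by rw [hpow i (Finset.mem_range.mp hi)]

/-- The leftmost factor is `Q_s`, so neither `f` nor the accuracy of the Lanczos approximation plays
a role. -/
theorem matRange_matvec_le (f : ℝ → ℝ) (hs : 0 < s) (hN : s ≤ N + 1) :
    matRange (L.matvec f hs) ≤ krylov A Ω s := by
  rw [← L.matRange_Q hN, matvec, Matrix.mul_assoc, matRange, Matrix.mulVecLin_mul]
  exact LinearMap.range_comp_le_range _ _

/-- The error of the leading submatrix of `f(T_{s+r})` as an approximation of the compression of
`f(A)` to the span of the first `s` blocks. -/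
theorem frobNorm_compress_sub_krylovAwareX_le (hA : A.IsSymm) (hN : s + r ≤ N) (f : ℝ → ℝ)
    {p : ℝ[X]} (hp : p.natDegree ≤ 2 * r + 1) {ε : ℝ} (hε : 0 ≤ ε)
    (h : ∀ x ∈ spectrum ℝ A ∪ spectrum ℝ (L.T (s + r)), |f x - p.eval x| ≤ ε) :
    frobNorm ((L.Q s)ᵀ * matFun f A * L.Q s - L.krylovAwareX f s r) ≤
      2 * (√((ℓ : ℝ) * s) * ε) := by
  have hT : (L.T (s + r)).IsSymm := by
    rw [L.T_eq hA hN, Matrix.IsSymm]; simp [transpose_mul, hA.eq, Matrix.mul_assoc]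
  have h1 := frobNorm_compress_matFun_sub_aeval_le hA f p hε (fun x hx => h x (.inl hx))
    (L.transpose_Q_mul_Q (show s ≤ N + 1 by omega))
  have h2 := frobNorm_compress_matFun_sub_aeval_le hT f p hε (fun x hx => h x (.inr hx))
    (L.transpose_leadingSelector_mul_self s r)
  have hcard : √(Fintype.card (L.Idx s) : ℝ) * ε ≤ √((ℓ : ℝ) * s) * ε := by
    refine mul_le_mul_of_nonneg_right (Real.sqrt_le_sqrt ?_) hε
    rw [L.card_idx (by omega)]
    exact_mod_cast finrank_krylov_le A Ω s
  -- The two compressions of `p` agree by exactness and cancel.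
  have h3 : (L.Q s)ᵀ * matFun f A * L.Q s - L.krylovAwareX f s r =
      (L.Q s)ᵀ * (matFun f A - aeval A p) * L.Q s - (L.leadingSelector s r)ᵀ *
        (matFun f (L.T (s + r)) - aeval (L.T (s + r)) p) * L.leadingSelector s r := by
    simp only [Matrix.mul_sub, Matrix.sub_mul, krylovAwareX_eq, L.compress_aeval_eq hA hN hp]
    abel
  rw [h3]
  linarith [frobNorm_sub_le ((L.Q s)ᵀ * (matFun f A - aeval A p) * L.Q s)
    ((L.leadingSelector s r)ᵀ * (matFun f (L.T (s + r)) - aeval (L.T (s + r)) p) *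
      L.leadingSelector s r)]

end BlockLanczosRun

/-! ### Truncation of an inexact core matrix, and the final bound -/

/-- Replacing the compression `Qᵀ F Q` by an approximation `X` before truncation costs at most
twice the error of `X`, in comparison with any approximation of `F` of rank at most `k` with range
and corange in the span of the columns of `Q`. -/
theorem frobNorm_sub_conj_truncated_le {m c : Type*} [Fintype m] [Fintype c] [DecidableEq c]
    {Q : Matrix m c ℝ} (hQ : Qᵀ * Q = 1) (F : Matrix m m ℝ) {k : ℕ} {X Y D : Matrix c c ℝ}
    (hY : IsTruncatedSVD k X Y) (hD : D.rank ≤ k) :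
    frobNorm (F - Q * Y * Qᵀ) ≤
      frobNorm (F - Q * D * Qᵀ) + 2 * frobNorm (Qᵀ * F * Q - X) := by
  set G := Qᵀ * F * Q
  -- The error `G - X` is paid twice: in passing from `G` to `X`, and in passing back after `Y` is
  -- compared with `D` as approximations of `X`.
  have h1 : frobNorm (G - Y) ≤ frobNorm (G - D) + 2 * frobNorm (G - X) := by
    have e1 := frobNorm_add_le (G - X) (X - Y)
    have e2 := hY.frobNorm_sub_le hD
    have e3 := frobNorm_sub_le (G - D) (G - X)
    rw [sub_add_sub_cancel] at e1
    rw [sub_sub_sub_cancel_left] at e3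
    linarith
  have h2 := frobNorm_sub_conj_sq hQ F Y
  have h3 := frobNorm_sub_conj_sq hQ F D
  have h4 : frobNorm (G - D) ≤ frobNorm (F - Q * D * Qᵀ) :=
    le_of_sq_le_sq (by rw [h3]; nlinarith [sq_nonneg (frobNorm (F - Q * G * Qᵀ))])
      (frobNorm_nonneg _)
  have n1 := frobNorm_nonneg (G - X)
  have n2 := frobNorm_nonneg (F - Q * D * Qᵀ)
  have n3 := pow_le_pow_left₀ (frobNorm_nonneg (G - Y)) h1 2
  -- With `η = ‖G - X‖`, squaring `h1` produces the cross term `4 η ‖G - D‖`, which `h4` bounds by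
  -- `4 η ‖F - Q D Qᵀ‖`; this completes the square.
  exact le_of_sq_le_sq (by nlinarith [mul_le_mul_of_nonneg_right h4 n1]) (by positivity)

theorem corollary3p1 {n ℓ : ℕ} (k s r : ℕ) (hk : k ≤ ℓ) (hs : 0 < s) (hr : 0 < r)
    (f : ℝ → ℝ) (A : Matrix (Fin n) (Fin n) ℝ) (hA : A.IsSymm)
    (lmin lmax : ℝ)
    (hmin : IsLeast {μ : ℝ | Module.End.HasEigenvalue (Matrix.toLin' A) μ} lmin)
    (hmax : IsGreatest {μ : ℝ | Module.End.HasEigenvalue (Matrix.toLin' A) μ} lmax)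
    (Ω : Matrix (Fin n) (Fin ℓ) ℝ)
    -- the Krylov-aware algorithm
    (L : BlockLanczosRun A Ω (s + r))
    (Xk : Matrix (L.Idx s) (L.Idx s) ℝ)
    (hXk : IsTruncatedSVD k (L.krylovAwareX f s r) Xk)
    -- the randomized SVD of `f(A)` with matrix-vector products by the block-Lanczos algorithm
    (L' : BlockLanczosRun A Ω s)
    {d : ℕ} (W : Matrix (Fin n) (Fin d) ℝ)
    (hW : IsOrthonormalBasisOfRange W (L'.matvec f hs))
    (L'' : BlockLanczosRun A W r)
    (Xk' : Matrix (Fin d) (Fin d) ℝ)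
    (hXk' : IsTruncatedSVD k (L''.quadForm f hr) Xk') :
    ENNReal.ofReal (frobNorm (matFun f A - L.Q s * Xk * (L.Q s)ᵀ)) ≤
      ENNReal.ofReal (frobNorm (matFun f A - W * Xk' * Wᵀ)) +
        ENNReal.ofReal (4 * √((ℓ : ℝ) * (s : ℝ))) * bestPolyError f (2 * r + 1) lmin lmax := by
  have hQ := L.transpose_Q_mul_Q (show s ≤ s + r + 1 by omega)
  have hWQ : L.Q s * ((L.Q s)ᵀ * W) = W := by
    refine mul_transpose_mul_of_matRange_le hQ ?_
    rw [hW.2, L.matRange_Q (by omega)]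
    exact L'.matRange_matvec_le f hs (by omega)
  set Z := (L.Q s)ᵀ * W
  have hrank : (Z * Xk' * Zᵀ).rank ≤ k :=
    (Matrix.rank_mul_le_left _ _).trans ((Matrix.rank_mul_le_right _ _).trans hXk'.rank_le)
  have hmain := frobNorm_sub_conj_truncated_le hQ (matFun f A) hXk hrank
  have hconj : L.Q s * (Z * Xk' * Zᵀ) * (L.Q s)ᵀ = W * Xk' * Wᵀ := by
    conv_rhs => rw [← hWQ]
    simp only [transpose_mul (L.Q s), Matrix.mul_assoc]
  rw [hconj] at hmain
  have hspecA : spectrum ℝ A ⊆ Set.Icc lmin lmax := by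
    intro x hx
    rw [← Matrix.spectrum_toLin', ← Module.End.hasEigenvalue_iff_mem_spectrum] at hx
    exact ⟨hmin.2 hx, hmax.2 hx⟩
  have hspecT : spectrum ℝ (L.T (s + r)) ⊆ Set.Icc lmin lmax := by
    rw [L.T_eq hA le_rfl]
    exact spectrum_compress_subset_Icc hA hspecA (L.transpose_Q_mul_Q (by omega))
  -- The infimum is pulled out, so one `p` can be fixed. The zero polynomial shows that the index
  -- set is nonempty, as needed when the coefficient vanishes; `0 * ⊤ = 0` then covers `ℓ = 0`.
  rw [bestPolyError, ENNReal.mul_iInf' (fun h => absurd h ENNReal.ofReal_ne_top)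
    (fun _ => ⟨⟨0, by simp⟩⟩), ENNReal.add_iInf]
  refine le_iInf fun p => ?_
  have hfin : (spectrum ℝ A ∪ spectrum ℝ (L.T (s + r))).Finite :=
    Matrix.finite_real_spectrum.union Matrix.finite_real_spectrum
  have hne : (spectrum ℝ A ∪ spectrum ℝ (L.T (s + r))).Nonempty := by
    refine ⟨lmin, .inl ?_⟩
    rw [← Matrix.spectrum_toLin', ← Module.End.hasEigenvalue_iff_mem_spectrum]
    exact hmin.1
  -- The supremum over the interval may be infinite, so the real error bound is the maximum over the
  -- finitely many eigenvalues of `A` and `T_{s+r}`.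
  obtain ⟨x₀, hx₀, hx₀max⟩ := hfin.exists_maximalFor (fun x => |f x - p.1.eval x|) _ hne
  have hle : ∀ x ∈ spectrum ℝ A ∪ spectrum ℝ (L.T (s + r)),
      |f x - p.1.eval x| ≤ |f x₀ - p.1.eval x₀| := fun x hx =>
    (le_total _ _).elim (fun h => h) fun h => hx₀max hx h
  have herr := L.frobNorm_compress_sub_krylovAwareX_le hA le_rfl f p.2 (abs_nonneg _) hle
  have hreal : frobNorm (matFun f A - L.Q s * Xk * (L.Q s)ᵀ) ≤
      frobNorm (matFun f A - W * Xk' * Wᵀ) +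
        4 * √((ℓ : ℝ) * (s : ℝ)) * |f x₀ - p.1.eval x₀| := by linarith
  calc _ ≤ ENNReal.ofReal (frobNorm (matFun f A - W * Xk' * Wᵀ)) +
        ENNReal.ofReal (4 * √((ℓ : ℝ) * (s : ℝ))) * ENNReal.ofReal |f x₀ - p.1.eval x₀| := by
        rw [← ENNReal.ofReal_mul (by positivity),
          ← ENNReal.ofReal_add (frobNorm_nonneg _) (by positivity)]
        exact ENNReal.ofReal_le_ofReal hreal
    _ ≤ _ := by
        gcongr
        exact le_iSup₂ (f := fun x _ => ENNReal.ofReal |f x - p.1.eval x|) x₀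
          (Set.union_subset hspecA hspecT hx₀)
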